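/- Let $\omega_1,\omega_3\in\mathbb C$ be linearly independent over $\mathbb R$, let $\wp$ be the Weierstrass function with periods $(2\omega_1,2\omega_3)$, and put $\omega_0=0$, $\omega_2=-\omega_1-\omega_3$, $e_k=\wp(\omega_k)$ $(k=1,2,3)$. Let $l_0,l_1,l_2,l_3\in\mathbb Z_{\ge 0}$, not all zero, $l=l_0+l_1+l_2+l_3$ and $u(x)=\sum_{i=0}^3 l_i(l_i+1)\wp(x+\omega_i)$. Let $$\Xi(x,E)=c_0(E)+\sum_{i=0}^3\sum_{j=0}^{l_i-1}b^{(i)}_j(E)\,\wp(x+\omega_i)^{l_i-j}$$ be the doubly periodic function whose coefficients $c_0,b^{(i)}_j\in\mathbb C[E]$ have no common divisor, with $c_0$ monic, and which satisfies, for every $E\in\mathbb C$, $$\Xi'''-4\,(u(x)-E)\,\Xi'-2u'(x)\,\Xi=0 \qquad ({}'=d/dx),$$ and let $Q(E)=\Xi^2(E-u)+\tfrac12\,\Xi\,\Xi''-\tfrac14(\Xi')^2$, which is independent of $x$. For $E\in\mathbb C$, define $\alpha$ as follows. * If $Q(E)\neq 0$, choose a square root $\sqrt{-Q(E)}$ and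 write $$\Xi(x,E)=\frac{C\prod_{j=1}^{l}(\wp(x)-\wp(t_j))}{\prod_{k=1}^3(\wp(x)-e_k)^{l_k}}$$ with $C$ independent of $x$, where the signs of $t_1,\dots,t_l$ are fixed by $\left.\frac{d\Xi}{dz}\right|_{z=\wp(t_j)}=-\frac{2\sqrt{-Q(E)}}{\wp'(t_j)}$, $z=\wp(x)$. Then $\alpha=-\sum_{j=1}^l t_j+\sum_{k=1}^3 l_k\omega_k$. * If $Q(E)=0$, write $$\Xi(x,E)=\frac{C\prod_{j=1}^{n}(\wp(x)-\wp(t_j))^2}{\prod_{k=1}^3(\wp(x)-e_k)^{\beta_k}}$$ with $\beta_i\in\{l_i,-l_i-1\}$ $(i=0,1,2,3)$, $n=(\beta_0+\beta_1+\beta_2+\beta_3)/2$, $C$ independent of $x$, and no $t_j$ congruent to a half-period. Then $\alpha=\sum_{k=1}^3\beta_k\omega_k$. Then $\alpha\to 0$ modulo $2\omega_1\mathbb Z\oplus 2\omega_3\mathbb Z$ as $E\to\infty$: for every $\varepsilon>0$ there is $R>0$ such that, for every $E\in\mathbb C$ with $|E|>R$ and every value of $\alpha$ at $E$ (for all choices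 of the square root and of the $t_j$), there is $w\in 2\omega_1\mathbb Z\oplus 2\omega_3\mathbb Z$ with $|\alpha-w|<\varepsilon$. -/

import Mathlib

open Polynomial

noncomputable section

namespace TreibichVerdier

/-- The half-periods `ω₀ = 0`, `ω₁`, `ω₂ = -ω₁ - ω₃`, `ω₃`.  The basic periods `2ω₁`, `2ω₃` of the
elliptic functions are the two members `L.ω₁`, `L.ω₂` of the pair `L`, so that the period lattice
`2ω₁ℤ ⊕ 2ω₃ℤ` is `L.lattice`. -/
def halfPeriod (L : PeriodPair) : Fin 4 → ℂ :=
  ![0, L.ω₁ / 2, -(L.ω₁ / 2) - L.ω₂ / 2, L.ω₂ / 2]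

/-- `x` is not congruent to a half-period modulo the period lattice. -/
def IsRegular (L : PeriodPair) (x : ℂ) : Prop := 2 * x ∉ L.lattice

/-- The numbers `e_k = ℘(ω_k)`, for `k = 1, 2, 3` (indexed here by `0, 1, 2`). -/
def e (L : PeriodPair) (k : Fin 3) : ℂ := L.weierstrassP (halfPeriod L k.succ)

/-- The potential `∑ l_i (l_i + 1) ℘(x + ω_i)` of the Hamiltonian `H`. -/
def potential (L : PeriodPair) (l : Fin 4 → ℕ) (x : ℂ) : ℂ :=
  ∑ i, (l i : ℂ) * (l i + 1) * L.weierstrassP (x + halfPeriod L i)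

/-- The derivative `∑ l_i (l_i + 1) ℘'(x + ω_i)` of the potential. -/
def potentialDeriv (L : PeriodPair) (l : Fin 4 → ℕ) (x : ℂ) : ℂ :=
  ∑ i, (l i : ℂ) * (l i + 1) * L.derivWeierstrassP (x + halfPeriod L i)

/-- The function
`Ξ(x, E) = c₀(E) + ∑_{i = 0}^{3} ∑_{j = 0}^{l_i - 1} b⁽ⁱ⁾_j(E) ℘(x + ω_i)^{l_i - j}`. -/
def Xi (L : PeriodPair) (l : Fin 4 → ℕ) (c₀ : ℂ[X]) (b : (i : Fin 4) → Fin (l i) → ℂ[X])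
    (x E : ℂ) : ℂ :=
  c₀.eval E + ∑ i, ∑ j : Fin (l i),
    (b i j).eval E * L.weierstrassP (x + halfPeriod L i) ^ (l i - (j : ℕ))

/-- The polynomials `c₀`, `b⁽ⁱ⁾_j` are the coefficients of the function `Ξ(x, E)` attached to
`l₀, l₁, l₂, l₃`: the polynomial `c₀` is monic, the coefficients have no common divisor, and for
every `E` the function `Ξ(·, E)` solves the third order equation satisfied by the products of two
solutions of `(H - E) f = 0`. -/
structure IsXi (L : PeriodPair) (l : Fin 4 → ℕ) (c₀ : ℂ[X])
    (b : (i : Fin 4) → Fin (l i) → ℂ[X]) : Prop where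
  monic : c₀.Monic
  coprime : ∀ d : ℂ[X], d ∣ c₀ → (∀ i j, d ∣ b i j) → IsUnit d
  ode : ∀ E x : ℂ, IsRegular L x →
    iteratedDeriv 3 (fun y => Xi L l c₀ b y E) x
      - 4 * (potential L l x - E) * deriv (fun y => Xi L l c₀ b y E) x
      - 2 * potentialDeriv L l x * Xi L l c₀ b x E = 0

/-- The expression
`Ξ² (E - ∑ l_i (l_i + 1) ℘(x + ω_i)) + (1/2) Ξ Ξ'' - (1/4) (Ξ')²`, as a function of `x` and `E`. -/
def QExpr (L : PeriodPair) (l : Fin 4 → ℕ) (c₀ : ℂ[X]) (b : (i : Fin 4) → Fin (l i) → ℂ[X])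
    (x E : ℂ) : ℂ :=
  Xi L l c₀ b x E ^ 2 * (E - potential L l x)
    + 1 / 2 * Xi L l c₀ b x E * iteratedDeriv 2 (fun y => Xi L l c₀ b y E) x
    - 1 / 4 * deriv (fun y => Xi L l c₀ b y E) x ^ 2

/-- `Q(E)`: the value of `QExpr` at the quarter-period `ω₁ / 2`.  By `QExpr_eq_Q` below, it is the
value at every `x` which is not a half-period. -/
def Q (L : PeriodPair) (l : Fin 4 → ℕ) (c₀ : ℂ[X]) (b : (i : Fin 4) → Fin (l i) → ℂ[X])
    (E : ℂ) : ℂ :=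
  QExpr L l c₀ b (L.ω₁ / 4) E

/-- `α` is a value at `E`, with `Q(E) ≠ 0`, of `α = -∑ t_j + ∑ l_k ω_k`.  Here `ν` is a square root
of `-Q(E)`, and `t₁, …, t_l` (with `l = l₀ + l₁ + l₂ + l₃`) are such that
`Ξ(x, E) = C ∏ (℘(x) - ℘(t_j)) / ∏ (℘(x) - e_k)^{l_k}`, with signs fixed by
`dΞ/dz (z_j) = -2 ν / ℘'(t_j)` for `z = ℘(x)`, `z_j = ℘(t_j)`, that is, by
`dΞ/dx (t_j) = -2 ν`.  As `Ξ(·, E)` is even about each half-period and `ν ≠ 0`,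
the last condition fails if `t_j` is a half-period. -/
def IsAlphaGeneric (L : PeriodPair) (l : Fin 4 → ℕ) (c₀ : ℂ[X])
    (b : (i : Fin 4) → Fin (l i) → ℂ[X]) (E α : ℂ) : Prop :=
  Q L l c₀ b E ≠ 0 ∧
  ∃ (ν C : ℂ) (t : Fin (∑ i, l i) → ℂ),
    ν ^ 2 = -Q L l c₀ b E ∧
    (∀ j, t j ∉ L.lattice) ∧
    (∀ x, IsRegular L x → Xi L l c₀ b x E =
      C * (∏ j, (L.weierstrassP x - L.weierstrassP (t j))) /
        ∏ k : Fin 3, (L.weierstrassP x - e L k) ^ l k.succ) ∧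
    (∀ j, deriv (fun x => Xi L l c₀ b x E) (t j) = -2 * ν) ∧
    α = -(∑ j, t j) + ∑ k : Fin 3, (l k.succ : ℂ) * halfPeriod L k.succ

/-- `α` is a value at `E`, with `Q(E) = 0`, of `α = ∑ β_k ω_k`.  Here `β_i ∈ {l_i, -l_i - 1}`
are the exponents in
`Ξ(x, E) = C ∏ (℘(x) - ℘(t_j))² / ∏ (℘(x) - e_k)^{β_k}`, where the number `n` of the `t_j` is
`(β₀ + β₁ + β₂ + β₃) / 2` and no `t_j` is a half-period. -/
def IsAlphaBranch (L : PeriodPair) (l : Fin 4 → ℕ) (c₀ : ℂ[X])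
    (b : (i : Fin 4) → Fin (l i) → ℂ[X]) (E α : ℂ) : Prop :=
  Q L l c₀ b E = 0 ∧
  ∃ (β : Fin 4 → ℤ) (n : ℕ) (C : ℂ) (t : Fin n → ℂ),
    (∀ i, β i = l i ∨ β i = -(l i : ℤ) - 1) ∧
    (∑ i, β i = 2 * (n : ℤ)) ∧
    (∀ j, IsRegular L (t j)) ∧
    (∀ x, IsRegular L x → Xi L l c₀ b x E =
      C * (∏ j, (L.weierstrassP x - L.weierstrassP (t j)) ^ 2) /
        ∏ k : Fin 3, (L.weierstrassP x - e L k) ^ β k.succ) ∧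
    α = ∑ k : Fin 3, (β k.succ : ℂ) * halfPeriod L k.succ

/-- `α` is one of the values of the parameter `α` at `E`. It depends on the choice of the square
root of `-Q(E)` and of representatives of the `t_j` modulo the period lattice. -/
def IsAlpha (L : PeriodPair) (l : Fin 4 → ℕ) (c₀ : ℂ[X])
    (b : (i : Fin 4) → Fin (l i) → ℂ[X]) (E α : ℂ) : Prop :=
  IsAlphaGeneric L l c₀ b E α ∨ IsAlphaBranch L l c₀ b E α

/-! Well-definedness of `Q(E)`. -/

theorem two_mul_halfPeriod_mem (L : PeriodPair) (i : Fin 4) :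
    2 * halfPeriod L i ∈ L.lattice := by
  rw [PeriodPair.mem_lattice]
  fin_cases i
  · exact ⟨0, 0, by simp [halfPeriod]⟩
  · exact ⟨1, 0, by simp [halfPeriod]; ring⟩
  · exact ⟨-1, -1, by simp [halfPeriod]; ring⟩
  · exact ⟨0, 1, by simp [halfPeriod]; ring⟩

theorem add_halfPeriod_notMem {L : PeriodPair} {x : ℂ} (hx : IsRegular L x) (i : Fin 4) :
    x + halfPeriod L i ∉ L.lattice := by
  intro h
  apply hx
  have h2 : (2 : ℤ) • (x + halfPeriod L i) - 2 * halfPeriod L i ∈ L.lattice :=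
    sub_mem (L.lattice.smul_mem 2 h) (two_mul_halfPeriod_mem L i)
  convert h2 using 1
  simp

theorem isRegular_quarter (L : PeriodPair) : IsRegular L (L.ω₁ / 4) := by
  have := L.ω₁_div_two_notMem_lattice
  unfold IsRegular
  convert this using 2
  ring

theorem isOpen_isRegular (L : PeriodPair) : IsOpen {x | IsRegular L x} :=
  L.isClosed_lattice.isOpen_compl.preimage (f := fun x : ℂ => 2 * x) (by fun_prop)

theorem isPreconnected_isRegular (L : PeriodPair) : IsPreconnected {x | IsRegular L x} := by
  have hc : ({x | 2 * x ∈ L.lattice} : Set ℂ).Countable := by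
    have : Countable (L.lattice : Set ℂ) := L.latticeEquivProd.toEquiv.countable_iff.mpr inferInstance
    have : (L.lattice : Set ℂ).Countable := Set.to_countable (L.lattice : Set ℂ)
    exact this.preimage (mul_right_injective₀ (two_ne_zero : (2 : ℂ) ≠ 0))
  have := hc.isConnected_compl_of_one_lt_rank (by
    rw [Complex.rank_real_complex]; norm_num : 1 < Module.rank ℝ ℂ)
  exact this.isPreconnected

theorem analyticAt_Xi (L : PeriodPair) (l : Fin 4 → ℕ) (c₀ : ℂ[X])
    (b : (i : Fin 4) → Fin (l i) → ℂ[X]) (E x : ℂ) (hx : IsRegular L x) :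
    AnalyticAt ℂ (fun y => Xi L l c₀ b y E) x := by
  have h : ∀ i, AnalyticAt ℂ (fun y => L.weierstrassP (y + halfPeriod L i)) x := fun i =>
    (L.analyticOnNhd_weierstrassP _ (add_halfPeriod_notMem hx i)).comp_of_eq
      (f := fun y => y + halfPeriod L i) (by fun_prop) rfl
  unfold Xi
  refine analyticAt_const.add (Finset.analyticAt_fun_sum _ fun i _ =>
    Finset.analyticAt_fun_sum _ fun j _ => analyticAt_const.mul ((h i).pow _))

theorem hasDerivAt_potential (L : PeriodPair) (l : Fin 4 → ℕ) (x : ℂ) (hx : IsRegular L x) :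
    HasDerivAt (potential L l) (potentialDeriv L l x) x := by
  unfold potential potentialDeriv
  refine HasDerivAt.fun_sum fun i _ => HasDerivAt.const_mul _ ?_
  have h := (L.analyticOnNhd_weierstrassP _ (add_halfPeriod_notMem hx i)).differentiableAt.hasDerivAt
  rw [L.deriv_weierstrassP] at h
  exact h.comp_add_const x _

/-- The expression `QExpr` is independent of `x`. -/
theorem QExpr_eq_Q {L : PeriodPair} {l : Fin 4 → ℕ} {c₀ : ℂ[X]}
    {b : (i : Fin 4) → Fin (l i) → ℂ[X]} (h : IsXi L l c₀ b) (E x : ℂ) (hx : IsRegular L x) :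
    QExpr L l c₀ b x E = Q L l c₀ b E := by
  have key : ∀ y, IsRegular L y → HasDerivAt (fun x => QExpr L l c₀ b x E) 0 y := by
    intro y hy
    have ha := analyticAt_Xi L l c₀ b E y hy
    have ho := h.ode E y hy
    unfold QExpr
    set f := fun y => Xi L l c₀ b y E with hf
    have h0 : HasDerivAt f (deriv f y) y := ha.differentiableAt.hasDerivAt
    have h1 : HasDerivAt (deriv f) (iteratedDeriv 2 f y) y := by
      rw [iteratedDeriv_succ, iteratedDeriv_one]
      exact ha.deriv.differentiableAt.hasDerivAt
    have h2 : HasDerivAt (iteratedDeriv 2 f) (iteratedDeriv 3 f y) y := by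
      rw [iteratedDeriv_succ (n := 2)]
      have : AnalyticAt ℂ (iteratedDeriv 2 f) y := by
        rw [iteratedDeriv_succ, iteratedDeriv_one]
        exact ha.deriv.deriv
      exact this.differentiableAt.hasDerivAt
    have hp := hasDerivAt_potential L l y hy
    have := (((h0.pow 2).mul (hp.const_sub E)).add ((h0.const_mul (1 / 2)).mul h2)).sub
      ((h1.pow 2).const_mul (1 / 4))
    refine this.congr_deriv ?_
    simp only [Pi.pow_apply]
    have hfy : f y = Xi L l c₀ b y E := rfl
    rw [← hfy] at ho
    push_cast
    linear_combination (1 / 2 * f y) * ho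
  exact (isOpen_isRegular L).is_const_of_deriv_eq_zero (isPreconnected_isRegular L)
    (fun y hy => (key y hy).differentiableAt.differentiableWithinAt)
    (fun y hy => (key y hy).deriv) hx (isRegular_quarter L)

end TreibichVerdier

end

/-!
As `E → ∞`, the function `Ξ(x, E)` is asymptotic to `E ^ g`, `g = deg c₀`, at every `x` which is not
a half-period, so the zeros `t_j` have to move to the poles of `Ξ`, which are half-periods, and `α`
becomes a combination of half-periods which turns out to be a period.

* Comparing the coefficients of the powers of `E` in the differential equation shows, by descending
  induction, that the polynomials `b⁽ⁱ⁾_j` have smaller degree than the monic polynomial `c₀`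
  (`coeff_eq_zero_of_natDegree_le`). Hence `Ξ(x, E) / E ^ g → 1`, its derivatives are of smaller
  order (`tendsto_iteratedDeriv_Xi_div_pow`), and `Q(E)` is asymptotic to `E ^ (2 g + 1)`. So the
  case `Q(E) = 0` does not occur near infinity (`eventually_Q_ne_zero`).
* Modulo periods, the `t_j` stay in a compact set. Along an ultrafilter which tends to infinity they
  converge, to limits `τ_j` say. The limit of the quotients `Ξ(x, E) / Ξ(y, E)`, written with the
  product formula, is an identity of polynomials in `℘(x)`: the product of the `X - ℘(τ_j)`, over the
  `τ_j` which are not periods, is proportional to `∏ (X - e_k) ^ l_k`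
  (`sum_limit_sub_sum_halfPeriod_mem`).
* The function `℘` takes the value `e_k` only at the points congruent to `ω_k`
  (`sub_mem_lattice_of_weierstrassP_eq`). Comparing roots, `l_k` of the `τ_j` are congruent to `ω_k`
  and the others are periods, so that `-∑ τ_j + ∑ l_k ω_k` is a period
  (`sum_sub_sum_halfPeriod_mem_of_prod_eq`). The signs of the `t_j` play no role, as the half-periods
  are congruent to their opposites.
-/

open Polynomial

namespace TreibichVerdier

open Filter Topology

/-! ### The Weierstrass function at the half-periods -/

variable (L : PeriodPair)

theorem tendsto_weierstrassP_cobounded {w : ℂ} (hw : w ∈ L.lattice) :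
    Tendsto L.weierstrassP (𝓝[≠] w) (Bornology.cobounded ℂ) := by
  apply tendsto_cobounded_of_meromorphicOrderAt_neg
  rw [L.order_weierstrassP w hw]
  decide

theorem halfPeriod_sub_notMem {i j : Fin 4} (hij : i ≠ j) :
    halfPeriod L i - halfPeriod L j ∉ L.lattice := by
  have key : ∀ a b : ℚ, (a.den ≠ 1 ∨ b.den ≠ 1) → (a : ℂ) * L.ω₁ + b * L.ω₂ ∉ L.lattice := by
    intro a b h h'
    rw [PeriodPair.mul_ω₁_add_mul_ω₂_mem_lattice] at h'
    tauto
  have h₁ : L.ω₁ / 2 ∉ L.lattice := L.ω₁_div_two_notMem_lattice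
  have h₃ : L.ω₂ / 2 ∉ L.lattice := L.ω₂_div_two_notMem_lattice
  have h₂ : L.ω₁ / 2 + L.ω₂ / 2 ∉ L.lattice := by
    convert key (1 / 2) (1 / 2) (by norm_num) using 2
    push_cast; ring
  -- Modulo the lattice every difference of distinct half-periods is one of these three.
  have aux : ∀ {x y : ℂ}, y ∉ L.lattice → (∃ m n : ℤ, x - y = m * L.ω₁ + n * L.ω₂) →
      x ∉ L.lattice := by
    rintro x y hy ⟨m, n, h⟩ hx
    refine hy ?_
    have : y = x - (x - y) := by ring
    rw [this, h]
    exact sub_mem hx (PeriodPair.mem_lattice.mpr ⟨m, n, rfl⟩)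
  fin_cases i <;> fin_cases j <;> simp [halfPeriod] at hij ⊢
  · exact h₁
  · exact aux h₂ ⟨0, 0, by push_cast; ring⟩
  · exact h₃
  · exact h₁
  · exact aux h₃ ⟨1, 0, by push_cast; ring⟩
  · exact aux h₂ ⟨0, -1, by push_cast; ring⟩
  · exact aux h₂ ⟨-1, -1, by push_cast; ring⟩
  · exact aux h₃ ⟨-1, -1, by push_cast; ring⟩
  · exact aux h₁ ⟨-1, -1, by push_cast; ring⟩
  · exact h₃
  · exact aux h₂ ⟨-1, 0, by push_cast; ring⟩
  · exact aux h₁ ⟨0, 1, by push_cast; ring⟩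

theorem halfPeriod_succ_notMem (k : Fin 3) : halfPeriod L k.succ ∉ L.lattice := by
  have := halfPeriod_sub_notMem L (Fin.succ_ne_zero k)
  simpa [halfPeriod] using this

variable {L}

theorem eventually_isRegular_sub_halfPeriod (i : Fin 4) :
    ∀ᶠ x in 𝓝[≠] (0 : ℂ), IsRegular L (x - halfPeriod L i) := by
  have h1 := L.compl_lattice_sdiff_singleton_mem_nhds (2 * (0 : ℂ))
  have h2 : ContinuousAt (fun x : ℂ => 2 * x) 0 := by fun_prop
  filter_upwards [nhdsWithin_le_nhds (h2.preimage_mem_nhds h1), self_mem_nhdsWithin]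
    with x hx hx0 hxL
  refine hx ⟨?_, by simpa using hx0⟩
  have := add_mem hxL (two_mul_halfPeriod_mem L i)
  rwa [← mul_add, sub_add_cancel] at this

theorem weierstrassP_add_mem (x : ℂ) {w : ℂ} (hw : w ∈ L.lattice) :
    L.weierstrassP (x + w) = L.weierstrassP x := L.weierstrassP_add_coe x ⟨w, hw⟩

theorem weierstrassP_sub_mem (x : ℂ) {w : ℂ} (hw : w ∈ L.lattice) :
    L.weierstrassP (x - w) = L.weierstrassP x := L.weierstrassP_sub_coe x ⟨w, hw⟩

theorem isPreconnected_compl_lattice : IsPreconnected (L.lattice : Set ℂ)ᶜ := by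
  have : Countable (L.lattice : Set ℂ) := L.latticeEquivProd.toEquiv.countable_iff.mpr inferInstance
  exact ((Set.to_countable (L.lattice : Set ℂ)).isConnected_compl_of_one_lt_rank (by
    rw [Complex.rank_real_complex]; norm_num : 1 < Module.rank ℝ ℂ)).isPreconnected

/-- Near a half-period `ω` which is not a lattice point, `℘ - ℘(ω)` has a zero of order at least
two, because `℘` is even about `ω`. -/
theorem exists_weierstrassP_sub_eq_sq_mul {ω : ℂ} (hω : ω ∉ L.lattice) (h2 : 2 * ω ∈ L.lattice) :
    ∃ q : ℂ → ℂ, AnalyticAt ℂ q 0 ∧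
      ∀ᶠ x in 𝓝 0, L.weierstrassP (x + ω) - L.weierstrassP ω = x ^ 2 * q x := by
  set f : ℂ → ℂ := fun x => L.weierstrassP (x + ω) - L.weierstrassP ω
  have ha : AnalyticAt ℂ f 0 :=
    ((L.analyticOnNhd_weierstrassP ω hω).comp_of_eq (f := fun x => x + ω) (by fun_prop)
      (by simp)).sub analyticAt_const
  have heven : ∀ x, f (-x) = f x := by
    intro x
    simp only [f]
    rw [← L.weierstrassP_neg, ← weierstrassP_sub_mem (x + ω) h2]
    congr 2; ring_nf
  have h0 : f 0 = 0 := by simp [f]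
  have h1 : deriv f 0 = 0 := by
    have : deriv (fun x => f (-x)) 0 = -deriv f (-0) := deriv_comp_neg f 0
    rw [funext heven, neg_zero] at this
    exact CharZero.eq_neg_self_iff.mp this
  have hord : (2 : ℕ) ≤ analyticOrderAt f 0 := by
    rw [natCast_le_analyticOrderAt_iff_iteratedDeriv_eq_zero ha]
    intro i hi
    interval_cases i
    · simpa using h0
    · simpa using h1
  obtain ⟨q, hq, h⟩ := (natCast_le_analyticOrderAt ha).mp hord
  exact ⟨q, hq, h.mono fun x hx => by simpa [f] using hx⟩

/-- If `ω` is a half-period and not a lattice point, then `℘` takes the value `℘(ω)` only at the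
points congruent to `ω`: the elliptic function `(℘(x) - ℘(ω)) (℘(x + ω) - ℘(ω))` has no pole,
since the double poles of each factor are cancelled by the double zeros of the other one, so it
is a constant, which is not zero. -/
theorem sub_mem_lattice_of_weierstrassP_eq {ω τ : ℂ} (hω : ω ∉ L.lattice)
    (h2 : 2 * ω ∈ L.lattice) (hτ : τ ∉ L.lattice)
    (h : L.weierstrassP τ = L.weierstrassP ω) : τ - ω ∈ L.lattice := by
  classical
  by_contra hτω
  obtain ⟨q, hq, hfq⟩ := exists_weierstrassP_sub_eq_sq_mul hω h2
  set g : ℂ → ℂ := fun x =>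
    (L.weierstrassP x - L.weierstrassP ω) * (L.weierstrassP (x + ω) - L.weierstrassP ω)
  -- `S` is the set of the poles of the two factors.
  set S : Set ℂ := {x | x ∈ L.lattice ∨ x - ω ∈ L.lattice}
  set G : ℂ → ℂ := fun x => if x ∈ S then q 0 else g x
  have hadd : ∀ x, x + ω ∈ L.lattice ↔ x - ω ∈ L.lattice := by
    intro x
    have : x + ω = (x - ω) + 2 * ω := by ring
    rw [this]
    exact L.lattice.add_mem_iff_left h2
  have hSL : ∀ x w, w ∈ L.lattice → (x + w ∈ S ↔ x ∈ S) := by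
    intro x w hw
    have : x + w - ω = (x - ω) + w := by ring
    simp only [S, Set.mem_ofPred_eq, this, L.lattice.add_mem_iff_left hw]
  have hSω : ∀ x, x + ω ∈ S ↔ x ∈ S := by
    intro x
    simp only [S, Set.mem_ofPred_eq, add_sub_cancel_right, hadd]
    tauto
  have hGL : ∀ x w, w ∈ L.lattice → G (x + w) = G x := by
    intro x w hw
    have : g (x + w) = g x := by
      simp only [g, weierstrassP_add_mem x hw, add_right_comm x w ω,
        weierstrassP_add_mem (x + ω) hw]
    simp only [G, hSL x w hw, this]
  have hGω : ∀ x, G (x + ω) = G x := by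
    intro x
    have : g (x + ω) = g x := by
      simp only [g]
      rw [add_assoc, ← two_mul, weierstrassP_add_mem x h2, mul_comm]
    simp only [G, hSω, this]
  have hScl : IsClosed S := by
    have : IsClosed {x | x - ω ∈ L.lattice} :=
      L.isClosed_lattice.preimage (f := fun x : ℂ => x - ω) (by fun_prop)
    exact L.isClosed_lattice.union this
  have hLpunct : ∀ᶠ x in 𝓝[≠] (0 : ℂ), x ∉ L.lattice := by
    have := nhdsWithin_le_nhds (s := {0}ᶜ) (L.compl_lattice_sdiff_singleton_mem_nhds 0)
    filter_upwards [this, self_mem_nhdsWithin] with x hx hx0 hxL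
    exact hx ⟨hxL, hx0⟩
  have hSpunct : ∀ᶠ x in 𝓝[≠] (0 : ℂ), x ∉ S := by
    have h1 : ∀ᶠ x in 𝓝 (0 : ℂ), x - ω ∉ L.lattice := by
      refine (L.isClosed_lattice.isOpen_compl.preimage
        (f := fun x : ℂ => x - ω) (by fun_prop)).mem_nhds ?_
      simpa using hω
    filter_upwards [hLpunct, nhdsWithin_le_nhds h1] with x hx hx' hxS
    exact hxS.elim hx hx'
  have hG0 : AnalyticAt ℂ G 0 := by
    have ha : AnalyticAt ℂ (fun x => (1 + x ^ 2 * (L.weierstrassPExcept 0 x - L.weierstrassP ω))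
        * q x) 0 := by
      have := L.analyticAt_weierstrassPExcept 0
      fun_prop
    -- The factor `1` comes from the principal part `1 / x ^ 2` of `℘` at `0`.
    refine ha.congr ?_
    have hev := eventually_nhdsWithin_iff.mp hSpunct
    filter_upwards [hfq, hev] with x hx hxS
    by_cases hx0 : x = 0
    · subst hx0
      simp [G, S]
    · have := L.weierstrassPExcept_add 0 x
      simp only [ZeroMemClass.coe_zero, sub_zero, ne_eq, OfNat.ofNat_ne_zero, not_false_eq_true,
        zero_pow, div_zero] at this
      simp only [G, if_neg (hxS hx0), g, hx, ← this]
      field_simp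
      ring
  have htrans : ∀ w, (∀ x, G (x + w) = G x) → AnalyticAt ℂ G w := by
    intro w hw
    have : G = fun x => G (x - w) := by
      funext x
      rw [← hw (x - w), sub_add_cancel]
    rw [this]
    exact hG0.comp_of_eq (f := fun x => x - w) (by fun_prop) (by simp)
  have hdiff : Differentiable ℂ G := by
    intro x
    by_cases hx : x ∈ S
    · refine (htrans x ?_).differentiableAt
      rcases hx with hx | hx
      · exact fun y => hGL y x hx
      · intro y
        have : y + x = (y + (x - ω)) + ω := by ring
        rw [this, hGω, hGL _ _ hx]
    · have hxL : x ∉ L.lattice := fun h => hx (Or.inl h)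
      have hxω : x + ω ∉ L.lattice := fun h => hx (Or.inr ((hadd x).mp h))
      have hg : DifferentiableAt ℂ g x := by
        have h1 := (L.analyticOnNhd_weierstrassP x hxL).differentiableAt
        have h3 : DifferentiableAt ℂ (fun x => L.weierstrassP (x + ω)) x :=
          (L.analyticOnNhd_weierstrassP (x + ω) hxω).differentiableAt.comp x
            (f := fun x => x + ω) (by fun_prop)
        exact (h1.sub_const _).mul (h3.sub_const _)
      refine hg.congr_of_eventuallyEq ?_
      filter_upwards [hScl.isOpen_compl.mem_nhds hx] with y hy
      exact if_neg hy
  have hbdd : Bornology.IsBounded (Set.range G) :=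
    (IsZLattice.isCompact_range_of_periodic L.lattice G hdiff.continuous hGL).isBounded
  have hGτ : G τ = 0 := by
    have hτS : τ ∉ S := fun hh => hh.elim hτ hτω
    simp [G, hτS, g, h]
  have hGzero : ∀ x, G x = 0 := fun x => by
    rw [← hGτ]; exact hdiff.apply_eq_apply_of_bounded hbdd x τ
  -- Near `0` the first factor does not vanish, so `℘` is constant near `ω`, hence everywhere.
  have hne := (tendsto_weierstrassP_cobounded L L.lattice.zero_mem).eventually
    (Bornology.eventually_ne_cobounded (L.weierstrassP ω))
  have hconst : ∀ᶠ x in 𝓝[≠] (0 : ℂ), L.weierstrassP (x + ω) = L.weierstrassP ω := by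
    filter_upwards [hne, hSpunct] with x hx hxS
    have := hGzero x
    simp only [G, if_neg hxS, g, mul_eq_zero, sub_eq_zero] at this
    exact this.resolve_left hx
  have hconst' : ∃ᶠ x in 𝓝[≠] ω, L.weierstrassP x = L.weierstrassP ω := by
    have ht : Tendsto (fun x : ℂ => x + ω) (𝓝[≠] 0) (𝓝[≠] ω) := by
      refine tendsto_nhdsWithin_iff.mpr ⟨?_, ?_⟩
      · have : Tendsto (fun x : ℂ => x + ω) (𝓝 0) (𝓝 (0 + ω)) :=
          (continuous_id.add continuous_const).tendsto 0
        rw [zero_add] at this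
        exact this.mono_left nhdsWithin_le_nhds
      · filter_upwards [self_mem_nhdsWithin] with x hx
        simpa using hx
    exact ht.frequently hconst.frequently
  have hall := L.analyticOnNhd_weierstrassP.eqOn_of_preconnected_of_frequently_eq
    (analyticOnNhd_const (v := L.weierstrassP ω)) isPreconnected_compl_lattice hω hconst'
  obtain ⟨x, hx, hxL⟩ := (hne.and hLpunct).exists
  exact hx (hall hxL)

theorem sub_halfPeriod_mem_of_weierstrassP_eq_e {k : Fin 3} {x : ℂ} (hx : x ∉ L.lattice)
    (h : L.weierstrassP x = e L k) : x - halfPeriod L k.succ ∈ L.lattice :=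
  sub_mem_lattice_of_weierstrassP_eq (halfPeriod_succ_notMem L k) (two_mul_halfPeriod_mem L _) hx h

theorem IsRegular.notMem {x : ℂ} (hx : IsRegular L x) : x ∉ L.lattice := fun h =>
  hx (by rw [two_mul]; exact add_mem h h)

theorem IsRegular.weierstrassP_ne_e {x : ℂ} (hx : IsRegular L x) (k : Fin 3) :
    L.weierstrassP x ≠ e L k := by
  intro h
  have h1 := sub_halfPeriod_mem_of_weierstrassP_eq_e hx.notMem h
  apply hx
  have : 2 * x = (x - halfPeriod L k.succ) + (x - halfPeriod L k.succ)
      + 2 * halfPeriod L k.succ := by ring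
  rw [this]
  exact add_mem (add_mem h1 h1) (two_mul_halfPeriod_mem L _)

theorem infinite_image_weierstrassP_isRegular :
    (L.weierstrassP '' {x | IsRegular L x}).Infinite := by
  intro hfin
  have h1 := (tendsto_weierstrassP_cobounded L L.lattice.zero_mem).eventually
    (Bornology.isBounded_def.mp hfin.isBounded)
  obtain ⟨x, hx, hreg⟩ := (h1.and (eventually_isRegular_sub_halfPeriod (L := L) 0)).exists
  rw [show halfPeriod L 0 = 0 from rfl, sub_zero] at hreg
  exact hx ⟨x, hreg, rfl⟩

/-! ### Behaviour of `Ξ(x, E)` and `Q(E)` as `E → ∞` -/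

variable {l : Fin 4 → ℕ} {c₀ : ℂ[X]} {b : (i : Fin 4) → Fin (l i) → ℂ[X]}

/-- If a sum of polynomials without constant term in the functions `℘(x + ω_i)` is constant, then
all its coefficients vanish: only the `i`-th polynomial is unbounded near `-ω_i`. -/
theorem eq_zero_of_sum_weierstrassP_pow_eq (a : (i : Fin 4) → Fin (l i) → ℂ) (K : ℂ)
    (h : ∀ x, IsRegular L x →
      ∑ i, ∑ j, a i j * L.weierstrassP (x + halfPeriod L i) ^ (l i - (j : ℕ)) = K)
    (i : Fin 4) (j : Fin (l i)) : a i j = 0 := by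
  classical
  set p : ℂ[X] := ∑ j : Fin (l i), C (a i j) * X ^ (l i - (j : ℕ))
  set r : ℂ → ℂ := fun x => ∑ i' ∈ Finset.univ.erase i, ∑ j : Fin (l i'),
    a i' j * L.weierstrassP (x - halfPeriod L i + halfPeriod L i') ^ (l i' - (j : ℕ))
  have hr : ContinuousAt r 0 := by
    refine tendsto_finsetSum _ fun i' hi' => tendsto_finsetSum _ fun j _ =>
      Tendsto.const_mul _ (Tendsto.pow ?_ _)
    have hn : (0 : ℂ) - halfPeriod L i + halfPeriod L i' ∉ L.lattice := by
      have := halfPeriod_sub_notMem L (Finset.ne_of_mem_erase hi')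
      rwa [zero_sub, neg_add_eq_sub]
    exact ContinuousAt.comp (f := fun x => x - halfPeriod L i + halfPeriod L i')
      (L.analyticOnNhd_weierstrassP _ hn).continuousAt (by fun_prop)
  have heq : ∀ᶠ x in 𝓝[≠] (0 : ℂ), p.eval (L.weierstrassP x) = K - r x := by
    filter_upwards [eventually_isRegular_sub_halfPeriod (L := L) i] with x hx
    rw [← h _ hx, ← Finset.add_sum_erase _ _ (Finset.mem_univ i)]
    simp [p, r, eval_finsetSum]
  have hdeg : ¬ 0 < p.degree := by
    intro hp
    have h1 := p.tendsto_norm_atTop hp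
      (tendsto_norm_cobounded_atTop.comp (tendsto_weierstrassP_cobounded L L.lattice.zero_mem))
    have h2 : Tendsto (fun x => ‖p.eval (L.weierstrassP x)‖) (𝓝[≠] 0) (𝓝 ‖K - r 0‖) :=
      ((tendsto_const_nhds.sub (hr.tendsto.mono_left nhdsWithin_le_nhds)).norm).congr'
        (heq.mono fun x hx => by simp [hx])
    exact not_tendsto_nhds_of_tendsto_atTop h1 _ h2
  have hcoeff : p.coeff (l i - (j : ℕ)) = 0 := by
    refine coeff_eq_zero_of_degree_lt (lt_of_le_of_lt (not_lt.mp hdeg) ?_)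
    exact_mod_cast Nat.sub_pos_of_lt j.2
  rw [finsetSum_coeff, Finset.sum_eq_single j] at hcoeff
  · simpa using hcoeff
  · intro j' _ hj'
    have : l i - (j : ℕ) ≠ l i - (j' : ℕ) := by
      have := j.2; have := j'.2; have := Fin.val_ne_of_ne hj'
      omega
    simp [coeff_X_pow, this]
  · simp

variable (L l c₀ b) in
/-- The coefficient of `E ^ n` in `Ξ(x, E)`, as a function of `x`. -/
noncomputable def xiCoeff (n : ℕ) (x : ℂ) : ℂ :=
  c₀.coeff n + ∑ i, ∑ j : Fin (l i),
    (b i j).coeff n * L.weierstrassP (x + halfPeriod L i) ^ (l i - (j : ℕ))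

theorem analyticAt_xiCoeff (n : ℕ) {x : ℂ} (hx : IsRegular L x) :
    AnalyticAt ℂ (xiCoeff L l c₀ b n) x := by
  have h : ∀ i, AnalyticAt ℂ (fun y => L.weierstrassP (y + halfPeriod L i)) x := fun i =>
    (L.analyticOnNhd_weierstrassP _ (add_halfPeriod_notMem hx i)).comp_of_eq
      (f := fun y => y + halfPeriod L i) (by fun_prop) rfl
  unfold xiCoeff
  exact analyticAt_const.add (Finset.analyticAt_fun_sum _ fun i _ =>
    Finset.analyticAt_fun_sum _ fun j _ => analyticAt_const.mul ((h i).pow _))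

theorem Xi_eq_sum_xiCoeff {N : ℕ} (hc : ∀ n, N ≤ n → c₀.coeff n = 0)
    (hb : ∀ n, N ≤ n → ∀ i j, (b i j).coeff n = 0) (x E : ℂ) :
    Xi L l c₀ b x E = ∑ n ∈ Finset.range N, E ^ n * xiCoeff L l c₀ b n x := by
  have heval : ∀ p : ℂ[X], (∀ n, N ≤ n → p.coeff n = 0) →
      p.eval E = ∑ n ∈ Finset.range N, E ^ n * p.coeff n := by
    intro p hp
    rw [eval_eq_sum, sum_def]
    simp_rw [mul_comm (E ^ _)]
    refine Finset.sum_subset (fun n hn => ?_) (fun n _ hn => ?_)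
    · rw [Finset.mem_range]
      by_contra hN
      exact (mem_support_iff.mp hn) (hp n (not_lt.mp hN))
    · rw [notMem_support_iff.mp hn, zero_mul]
  simp only [Xi, xiCoeff, mul_add, Finset.sum_add_distrib, Finset.mul_sum, ← mul_assoc]
  rw [heval c₀ hc, Finset.sum_comm]
  congr 1
  refine Finset.sum_congr rfl fun i _ => ?_
  rw [Finset.sum_comm]
  refine Finset.sum_congr rfl fun j _ => ?_
  rw [heval _ fun n hn => hb n hn i j, Finset.sum_mul]

theorem iteratedDeriv_Xi {N : ℕ} (hc : ∀ n, N ≤ n → c₀.coeff n = 0)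
    (hb : ∀ n, N ≤ n → ∀ i j, (b i j).coeff n = 0) (k : ℕ) {x : ℂ} (hx : IsRegular L x) (E : ℂ) :
    iteratedDeriv k (fun y => Xi L l c₀ b y E) x =
      ∑ n ∈ Finset.range N, E ^ n * iteratedDeriv k (xiCoeff L l c₀ b n) x := by
  simp_rw [Xi_eq_sum_xiCoeff hc hb]
  have ha : ∀ n, ContDiffAt ℂ k (xiCoeff L l c₀ b n) x := fun n =>
    (analyticAt_xiCoeff n hx).contDiffAt
  rw [iteratedDeriv_fun_sum fun n _ => contDiffAt_const.mul (ha n)]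
  exact Finset.sum_congr rfl fun n _ => iteratedDeriv_const_mul_field _ _

variable (c₀ b) in
theorem exists_coeff_eq_zero :
    ∃ N, (∀ n, N ≤ n → c₀.coeff n = 0) ∧ ∀ n, N ≤ n → ∀ i j, (b i j).coeff n = 0 := by
  refine ⟨c₀.natDegree + ∑ i, ∑ j, (b i j).natDegree + 1, fun n hn => ?_, fun n hn i j => ?_⟩
  · exact coeff_eq_zero_of_natDegree_lt (by omega)
  · have h1 : (b i j).natDegree ≤ ∑ j, (b i j).natDegree :=
      Finset.single_le_sum (f := fun j => (b i j).natDegree) (fun _ _ => Nat.zero_le _)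
        (Finset.mem_univ j)
    have h2 : ∑ j, (b i j).natDegree ≤ ∑ i, ∑ j, (b i j).natDegree :=
      Finset.single_le_sum (f := fun i => ∑ j, (b i j).natDegree) (fun _ _ => Nat.zero_le _)
        (Finset.mem_univ i)
    exact coeff_eq_zero_of_natDegree_lt (by omega)

/-- The coefficient of `E ^ (n + 1)` in the differential equation for `Ξ(x, E)`. -/
theorem xiCoeff_recurrence (h : IsXi L l c₀ b) (n : ℕ) {x : ℂ} (hx : IsRegular L x) :
    iteratedDeriv 3 (xiCoeff L l c₀ b (n + 1)) x
      - 4 * potential L l x * deriv (xiCoeff L l c₀ b (n + 1)) x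
      - 2 * potentialDeriv L l x * xiCoeff L l c₀ b (n + 1) x
      + 4 * deriv (xiCoeff L l c₀ b n) x = 0 := by
  obtain ⟨N, hc, hb⟩ := exists_coeff_eq_zero c₀ b
  set f := xiCoeff L l c₀ b with hf
  have hfN : ∀ n, N ≤ n → f n = 0 := by
    intro n hn
    funext y
    simp [hf, xiCoeff, hc n hn, hb n hn]
  set A : ℕ → ℂ := fun n => iteratedDeriv 3 (f n) x - 4 * potential L l x * deriv (f n) x
    - 2 * potentialDeriv L l x * f n x
  set p : ℂ[X] := (∑ n ∈ Finset.range N, C (A n) * X ^ n)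
    + (∑ n ∈ Finset.range N, C (4 * deriv (f n) x) * X ^ n) * X
  have hp : p = 0 := by
    refine funext fun E => ?_
    have ho := h.ode E x hx
    have h1 := iteratedDeriv_Xi hc hb 1 hx E
    simp only [iteratedDeriv_one] at h1
    rw [iteratedDeriv_Xi hc hb 3 hx, h1, Xi_eq_sum_xiCoeff hc hb] at ho
    rw [eval_zero, ← ho]
    simp only [p, A, eval_add, eval_mul, eval_finsetSum, eval_C, eval_pow, eval_X, ← hf,
      Finset.mul_sum, Finset.sum_mul, ← Finset.sum_add_distrib, ← Finset.sum_sub_distrib]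
    exact Finset.sum_congr rfl fun n _ => by ring
  have hcoeff : ∀ (B : ℕ → ℂ) (m : ℕ), (N ≤ m → B m = 0) →
      (∑ n ∈ Finset.range N, C (B n) * X ^ n).coeff m = B m := by
    intro B m hB
    simp only [finsetSum_coeff, coeff_C_mul, coeff_X_pow, mul_ite, mul_one, mul_zero,
      Finset.sum_ite_eq, Finset.mem_range]
    split_ifs with hm
    · rfl
    · exact (hB (not_lt.mp hm)).symm
  have hzero : deriv (0 : ℂ → ℂ) x = 0 ∧ iteratedDeriv 3 (0 : ℂ → ℂ) x = 0 := by
    constructor <;> simp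
  have := congrArg (fun q => q.coeff (n + 1)) hp
  simp only [p, coeff_add, coeff_mul_X, coeff_zero] at this
  rw [hcoeff _ _ fun hn => by simp [A, hfN _ hn, hzero], hcoeff _ _ fun hn => by
    simp [hfN _ hn, hzero]] at this
  exact this

/-- The degrees of the polynomials `b⁽ⁱ⁾_j` are less than the degree of `c₀`. -/
theorem coeff_eq_zero_of_natDegree_le (h : IsXi L l c₀ b) {n : ℕ} (hn : c₀.natDegree ≤ n)
    (i : Fin 4) (j : Fin (l i)) : (b i j).coeff n = 0 := by
  obtain ⟨N, -, hb⟩ := exists_coeff_eq_zero c₀ b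
  -- Descending induction: if the coefficient of `E ^ (n + 1)` in `Ξ` vanishes, then by the recurrence
  -- the coefficient of `E ^ n` is a constant function.
  suffices H : ∀ k n, c₀.natDegree ≤ n → N ≤ n + k → ∀ i j, (b i j).coeff n = 0 from
    H N n hn (by omega) i j
  intro k
  induction k with
  | zero => exact fun n _ hN => hb n hN
  | succ k ih =>
    intro n hn hN
    have hf : xiCoeff L l c₀ b (n + 1) = 0 := by
      funext y
      simp [xiCoeff, coeff_eq_zero_of_natDegree_lt (Nat.lt_succ_of_le hn),
        ih (n + 1) (by omega) (by omega)]
    have hd : ∀ x, IsRegular L x → deriv (xiCoeff L l c₀ b n) x = 0 := by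
      intro x hx
      have := xiCoeff_recurrence h n hx
      simpa [hf] using this
    refine eq_zero_of_sum_weierstrassP_pow_eq (L := L) (fun i j => (b i j).coeff n)
      (xiCoeff L l c₀ b n (L.ω₁ / 4) - c₀.coeff n) fun x hx => ?_
    have := (isOpen_isRegular L).is_const_of_deriv_eq_zero (isPreconnected_isRegular L)
      (fun y hy => (analyticAt_xiCoeff (b := b) (c₀ := c₀) n hy).differentiableAt
        |>.differentiableWithinAt) hd (isRegular_quarter L) hx
    rw [this, xiCoeff, add_sub_cancel_left]

theorem xiCoeff_natDegree (h : IsXi L l c₀ b) : xiCoeff L l c₀ b c₀.natDegree = fun _ => 1 := by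
  funext x
  simp [xiCoeff, coeff_eq_zero_of_natDegree_le h le_rfl, h.monic.coeff_natDegree]

theorem tendsto_sum_pow_mul_div_pow (a : ℕ → ℂ) (g : ℕ) :
    Tendsto (fun E : ℂ => (∑ n ∈ Finset.range (g + 1), E ^ n * a n) / E ^ g)
      (Bornology.cobounded ℂ) (𝓝 (a g)) := by
  have hlim : Tendsto (fun E : ℂ => ∑ n ∈ Finset.range (g + 1), E⁻¹ ^ (g - n) * a n)
      (Bornology.cobounded ℂ) (𝓝 (∑ n ∈ Finset.range (g + 1), 0 ^ (g - n) * a n)) :=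
    tendsto_finsetSum _ fun n _ => (tendsto_inv₀_cobounded.pow _).mul_const _
  have hval : ∑ n ∈ Finset.range (g + 1), (0 : ℂ) ^ (g - n) * a n = a g := by
    rw [Finset.sum_range_succ, Finset.sum_eq_zero]
    · simp
    · intro n hn
      rw [zero_pow (Nat.sub_ne_zero_of_lt (Finset.mem_range.mp hn)), zero_mul]
  rw [hval] at hlim
  refine hlim.congr' ?_
  filter_upwards [Bornology.eventually_ne_cobounded (0 : ℂ)] with E hE
  rw [Finset.sum_div]
  refine Finset.sum_congr rfl fun n hn => ?_
  have : g = n + (g - n) := by have := Finset.mem_range.mp hn; omega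
  have hpow : E ^ g = E ^ n * E ^ (g - n) := by rw [← pow_add, ← this]
  rw [hpow, inv_pow]
  field_simp

theorem tendsto_iteratedDeriv_Xi_div_pow (h : IsXi L l c₀ b) (k : ℕ) {x : ℂ}
    (hx : IsRegular L x) :
    Tendsto (fun E => iteratedDeriv k (fun y => Xi L l c₀ b y E) x / E ^ c₀.natDegree)
      (Bornology.cobounded ℂ) (𝓝 (iteratedDeriv k (fun _ : ℂ => (1 : ℂ)) x)) := by
  rw [← xiCoeff_natDegree h]
  simp_rw [iteratedDeriv_Xi (N := c₀.natDegree + 1)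
    (fun n hn => coeff_eq_zero_of_natDegree_lt (p := c₀) (by omega))
    (fun n hn => coeff_eq_zero_of_natDegree_le h (by omega)) k hx]
  exact tendsto_sum_pow_mul_div_pow _ _

/-- Away from its poles, `Ξ(x, E)` is asymptotic to `E ^ g`, where `g` is the degree of `c₀`. -/
theorem tendsto_Xi_div_pow (h : IsXi L l c₀ b) {x : ℂ} (hx : IsRegular L x) :
    Tendsto (fun E => Xi L l c₀ b x E / E ^ c₀.natDegree) (Bornology.cobounded ℂ) (𝓝 1) := by
  simpa using tendsto_iteratedDeriv_Xi_div_pow h 0 hx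

/-- `Q(E)` is asymptotic to `E ^ (2 g + 1)`, so that it has no zeros near infinity. -/
theorem eventually_Q_ne_zero (h : IsXi L l c₀ b) :
    ∀ᶠ E in Bornology.cobounded ℂ, Q L l c₀ b E ≠ 0 := by
  have hx := isRegular_quarter L
  set x := L.ω₁ / 4
  have h0 := tendsto_Xi_div_pow h hx
  have h1 := tendsto_iteratedDeriv_Xi_div_pow h 1 hx
  have h2 := tendsto_iteratedDeriv_Xi_div_pow h 2 hx
  simp only [iteratedDeriv_one, iteratedDeriv_const] at h1 h2
  have hinv : Tendsto (fun E : ℂ => E⁻¹) (Bornology.cobounded ℂ) (𝓝 0) := tendsto_inv₀_cobounded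
  have hlim := (((h0.pow 2).mul ((tendsto_const_nhds (x := (1 : ℂ))).sub (hinv.const_mul (potential L l x)))).add
    (hinv.mul ((h0.const_mul (1 / 2)).mul h2))).sub (hinv.mul ((h1.pow 2).const_mul (1 / 4)))
  have hone : ∀ᶠ z : ℂ in 𝓝 1, z ≠ 0 := isOpen_ne.mem_nhds one_ne_zero
  norm_num at hlim
  filter_upwards [hlim.eventually hone, Bornology.eventually_ne_cobounded (0 : ℂ)] with E hE hE0
  contrapose! hE
  have hQ : Q L l c₀ b E / (E * (E ^ c₀.natDegree) ^ 2) = 0 := by rw [hE, zero_div]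
  rw [Q, QExpr] at hQ
  rw [← hQ]
  field_simp
  ring

/-! ### The limits of the zeros of `Ξ(x, E)` -/

variable (L) in
theorem exists_isCompact_forall_exists_sub_mem :
    ∃ K : Set ℂ, IsCompact K ∧ ∀ z, ∃ w ∈ L.lattice, z - w ∈ K := by
  refine ⟨Metric.closedBall 0 (∑ i, ‖L.basis i‖), isCompact_closedBall _ _, fun z => ?_⟩
  refine ⟨ZSpan.floor L.basis z, ?_, ?_⟩
  · rw [L.lattice_eq_span_range_basis]
    exact (ZSpan.floor L.basis z).2
  · rw [← ZSpan.fract_apply, mem_closedBall_zero_iff]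
    exact ZSpan.norm_fract_le L.basis z

/-- If the polynomial `∏ (X - ℘(τ_j))` is proportional to `∏ (X - e_k) ^ m_k`, then the sum of the
`τ_j` is congruent to `∑ m_k ω_k`: the two polynomials have the same roots, and `℘(τ_j) = e_k`
implies that `τ_j` is congruent to `ω_k`. -/
theorem sum_sub_sum_halfPeriod_mem_of_prod_eq {ι : Type*} (J : Finset ι) (τ : ι → ℂ)
    (hτ : ∀ j ∈ J, τ j ∉ L.lattice) (m : Fin 3 → ℕ) {A B : ℂ} (hA : A ≠ 0)
    (h : C A * ∏ j ∈ J, (X - C (L.weierstrassP (τ j)))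
      = C B * ∏ k : Fin 3, (X - C (e L k)) ^ m k) :
    ∑ j ∈ J, τ j - ∑ k : Fin 3, (m k : ℂ) * halfPeriod L k.succ ∈ L.lattice := by
  classical
  have hP : ∏ j ∈ J, (X - C (L.weierstrassP (τ j))) ≠ 0 :=
    Finset.prod_ne_zero_iff.mpr fun j _ => X_sub_C_ne_zero _
  have hD : ∏ k : Fin 3, (X - C (e L k)) ^ m k ≠ 0 :=
    Finset.prod_ne_zero_iff.mpr fun k _ => pow_ne_zero _ (X_sub_C_ne_zero _)
  have hB : B ≠ 0 := by
    rintro rfl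
    rw [C_0, zero_mul] at h
    exact mul_ne_zero (C_ne_zero.mpr hA) hP h
  have hroots := congrArg roots h
  rw [roots_C_mul _ hA, roots_C_mul _ hB, roots_prod _ _ hP, roots_prod _ _ hD] at hroots
  simp only [roots_X_sub_C, roots_pow] at hroots
  -- The class in `ℂ ⧸ L.lattice` of the points where `℘` takes the value `z`, if `z` is some `e_k`.
  set c : ℂ → ℂ ⧸ L.lattice := fun z =>
    if H : ∃ k, z = e L k then Submodule.Quotient.mk (halfPeriod L H.choose.succ) else 0
  have hc : ∀ x, x ∉ L.lattice → (∃ k, L.weierstrassP x = e L k) →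
      c (L.weierstrassP x) = Submodule.Quotient.mk x := by
    intro x hx H
    simp only [c, dif_pos H]
    refine ((Submodule.Quotient.eq _).mpr ?_).symm
    exact sub_halfPeriod_mem_of_weierstrassP_eq_e hx H.choose_spec
  have hJ : ∀ j ∈ J, ∃ k, L.weierstrassP (τ j) = e L k := by
    intro j hj
    have : L.weierstrassP (τ j) ∈ J.val.bind fun j => {L.weierstrassP (τ j)} :=
      Multiset.mem_bind.mpr ⟨j, hj, Multiset.mem_singleton_self _⟩
    rw [hroots] at this
    obtain ⟨k, -, hk⟩ := Multiset.mem_bind.mp this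
    exact ⟨k, Multiset.mem_singleton.mp (Multiset.mem_of_mem_nsmul hk)⟩
  have hsum := congrArg (fun s => (s.map c).sum) hroots
  simp only [Multiset.map_bind, Multiset.sum_bind, Multiset.map_singleton, Multiset.sum_singleton,
    Multiset.map_nsmul, Multiset.sum_nsmul] at hsum
  change ∑ j ∈ J, c (L.weierstrassP (τ j)) = ∑ k : Fin 3, m k • c (e L k) at hsum
  rw [Finset.sum_congr rfl fun j hj => hc (τ j) (hτ j hj) (hJ j hj),
    Finset.sum_congr rfl fun k _ => congrArg (m k • ·)
      (show c (e L k) = _ from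
        hc (halfPeriod L k.succ) (halfPeriod_succ_notMem L k) ⟨k, rfl⟩)] at hsum
  rw [← Submodule.Quotient.eq]
  simp only [← Submodule.mkQ_apply, map_sum] at hsum ⊢
  rw [hsum]
  refine Finset.sum_congr rfl fun k _ => ?_
  rw [← map_nsmul, nsmul_eq_mul]

/-- The sum of the limits of the zeros of `Ξ(x, E)` as `E → ∞`. The zeros which tend to lattice
points disappear from the limit of `∏ (℘(x) - ℘(t_j)) / (℘(y) - ℘(t_j))`, which is therefore the
product over the others; as `Ξ(x, E) / Ξ(y, E) → 1`, these are distributed among the half-periods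
according to the multiplicities of the denominator of `Ξ`. -/
theorem sum_limit_sub_sum_halfPeriod_mem (h : IsXi L l c₀ b) {F : Filter ℂ} [F.NeBot]
    (hF : F ≤ Bornology.cobounded ℂ) {ι : Type*} [Fintype ι] (A : ℂ → ℂ) (t : ℂ → ι → ℂ)
    (τ : ι → ℂ) (hτ : ∀ j, Tendsto (fun E => t E j) F (𝓝 (τ j)))
    (ht : ∀ᶠ E in F, ∀ j, t E j ∉ L.lattice)
    (hprod : ∀ᶠ E in F, ∀ x, IsRegular L x → Xi L l c₀ b x E =
      A E * (∏ j, (L.weierstrassP x - L.weierstrassP (t E j))) /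
        ∏ k : Fin 3, (L.weierstrassP x - e L k) ^ l k.succ) :
    ∑ j, τ j - ∑ k : Fin 3, (l k.succ : ℂ) * halfPeriod L k.succ ∈ L.lattice := by
  classical
  set D : ℂ → ℂ := fun x => ∏ k : Fin 3, (L.weierstrassP x - e L k) ^ l k.succ
  have hD : ∀ x, IsRegular L x → D x ≠ 0 := fun x hx =>
    Finset.prod_ne_zero_iff.mpr fun k _ => pow_ne_zero _ (sub_ne_zero.mpr (hx.weierstrassP_ne_e k))
  set J : Finset ι := Finset.univ.filter fun j => τ j ∉ L.lattice
  -- The normalizing divisors make the factors with `℘(t_j) → ∞` converge to `1`.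
  set v : ι → ℂ → ℂ := fun j E => if τ j ∈ L.lattice then -L.weierstrassP (t E j) else 1
  have hfactor : ∀ x j, Tendsto (fun E => (L.weierstrassP x - L.weierstrassP (t E j)) / v j E) F
      (𝓝 (if τ j ∉ L.lattice then L.weierstrassP x - L.weierstrassP (τ j) else 1)) := by
    intro x j
    by_cases hj : τ j ∈ L.lattice
    · have hpunct : Tendsto (fun E => t E j) F (𝓝[≠] τ j) :=
        tendsto_nhdsWithin_iff.mpr ⟨hτ j, ht.mono fun E hE heq => hE j (by
          rw [Set.mem_singleton_iff.mp heq]; exact hj)⟩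
      have hinf := (tendsto_weierstrassP_cobounded L hj).comp hpunct
      have hlim := (tendsto_const_nhds (x := (1 : ℂ))).sub
        ((tendsto_inv₀_cobounded.comp hinf).const_mul (L.weierstrassP x))
      simp only [hj, not_true_eq_false, if_false, v, if_true]
      rw [mul_zero, sub_zero] at hlim
      refine hlim.congr' ?_
      filter_upwards [hinf.eventually (Bornology.eventually_ne_cobounded 0)] with E hE
      simp only [Function.comp_apply] at hE ⊢
      field_simp
      ring
    · simp only [hj, not_false_eq_true, if_true, v, if_false, div_one]
      exact tendsto_const_nhds.sub
        ((L.analyticOnNhd_weierstrassP _ hj).continuousAt.tendsto.comp (hτ j))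
  have hlim : ∀ x, Tendsto (fun E => ∏ j, (L.weierstrassP x - L.weierstrassP (t E j)) / v j E) F
      (𝓝 (∏ j ∈ J, (L.weierstrassP x - L.weierstrassP (τ j)))) := by
    intro x
    rw [Finset.prod_filter]
    exact tendsto_finsetProd _ fun j _ => hfactor x j
  have hid : ∀ x y, IsRegular L x → IsRegular L y →
      D x * ∏ j ∈ J, (L.weierstrassP y - L.weierstrassP (τ j))
        = D y * ∏ j ∈ J, (L.weierstrassP x - L.weierstrassP (τ j)) := by
    have hlim' : ∀ x y, IsRegular L x → Tendsto (fun E => Xi L l c₀ b x E / E ^ c₀.natDegree *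
        (D x * ∏ j, (L.weierstrassP y - L.weierstrassP (t E j)) / v j E)) F
        (𝓝 (D x * ∏ j ∈ J, (L.weierstrassP y - L.weierstrassP (τ j)))) := by
      intro x y hx
      have := ((tendsto_Xi_div_pow h hx).mono_left hF).mul ((hlim y).const_mul (D x))
      rwa [one_mul] at this
    intro x y hx hy
    refine tendsto_nhds_unique (hlim' x y hx) ((hlim' y x hy).congr' ?_)
    filter_upwards [hprod] with E hE
    have hxE := hE x hx
    have hyE := hE y hy
    rw [eq_div_iff (hD x hx)] at hxE
    rw [eq_div_iff (hD y hy)] at hyE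
    simp only [Finset.prod_div_distrib]
    linear_combination ((∏ j, (L.weierstrassP x - L.weierstrassP (t E j))) / E ^ c₀.natDegree
      / ∏ j, v j E) * hyE - ((∏ j, (L.weierstrassP y - L.weierstrassP (t E j)))
      / E ^ c₀.natDegree / ∏ j, v j E) * hxE
  have hy := isRegular_quarter L
  set y := L.ω₁ / 4
  have hpoly : C (D y) * ∏ j ∈ J, (X - C (L.weierstrassP (τ j)))
      = C (∏ j ∈ J, (L.weierstrassP y - L.weierstrassP (τ j)))
        * ∏ k : Fin 3, (X - C (e L k)) ^ l k.succ := by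
    refine eq_of_infinite_eval_eq _ _ ((infinite_image_weierstrassP_isRegular (L := L)).mono ?_)
    rintro _ ⟨x, hx, rfl⟩
    have := hid x y hx hy
    simp only [Set.mem_ofPred_eq, eval_mul, eval_C, eval_prod, eval_sub, eval_X, eval_pow]
    rw [← this, mul_comm]
  have hmem := sum_sub_sum_halfPeriod_mem_of_prod_eq J τ
    (fun j hj => (Finset.mem_filter.mp hj).2) (fun k => l k.succ) (hD y hy) hpoly
  have hrest : ∑ j ∈ Finset.univ.filter (fun j => ¬ τ j ∉ L.lattice), τ j ∈ L.lattice :=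
    sum_mem fun j hj => not_not.mp (Finset.mem_filter.mp hj).2
  rw [← Finset.sum_filter_add_sum_filter_not Finset.univ (fun j => τ j ∉ L.lattice) τ,
    add_sub_right_comm]
  exact add_mem hmem hrest

end TreibichVerdier

/-! ### The limit of `α` -/

open TreibichVerdier Filter Topology

theorem proposition2p4 (L : PeriodPair) (l : Fin 4 → ℕ) (hl : l ≠ 0)
    (c₀ : Polynomial ℂ) (b : (i : Fin 4) → Fin (l i) → Polynomial ℂ)
    (hXi : TreibichVerdier.IsXi L l c₀ b) :
    ∀ ε : ℝ, 0 < ε → ∀ᶠ E in Bornology.cobounded ℂ, ∀ α : ℂ,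
      TreibichVerdier.IsAlpha L l c₀ b E α → ∃ w ∈ L.lattice, ‖α - w‖ < ε := by
  intro ε hε
  refine mem_iff_ultrafilter.mpr fun U hU => ?_
  by_contra hbad
  obtain ⟨K, hK, hred⟩ := exists_isCompact_forall_exists_sub_mem L
  -- `d` lists a value `α` far from all periods, the constant factor, the representatives of the
  -- `t_j` in `K`, and the periods by which the `t_j` differ from these.
  have hex : ∀ᶠ E in (U : Filter ℂ), ∃ d : ℂ × ℂ × (Fin (∑ i, l i) → ℂ) × (Fin (∑ i, l i) → ℂ),
      (∀ w ∈ L.lattice, ε ≤ ‖d.1 - w‖) ∧ (∀ j, d.2.2.1 j ∈ K) ∧ (∀ j, d.2.2.1 j ∉ L.lattice) ∧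
      (∀ j, d.2.2.2 j ∈ L.lattice) ∧
      (∀ x, IsRegular L x → Xi L l c₀ b x E =
        d.2.1 * (∏ j, (L.weierstrassP x - L.weierstrassP (d.2.2.1 j))) /
          ∏ k : Fin 3, (L.weierstrassP x - e L k) ^ l k.succ) ∧
      d.1 = -(∑ j, (d.2.2.1 j + d.2.2.2 j))
        + ∑ k : Fin 3, (l k.succ : ℂ) * halfPeriod L k.succ := by
    filter_upwards [Ultrafilter.compl_mem_iff_notMem.mpr hbad, hU (eventually_Q_ne_zero hXi)]
      with E hE hQ
    simp only [Set.mem_compl_iff, Set.mem_ofPred_eq, not_forall, not_exists, not_and, not_lt]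
      at hE hQ
    obtain ⟨α, hα, hfar⟩ := hE
    obtain ⟨-, ν, A, t, -, htL, hprod, -, rfl⟩ := hα.resolve_right fun hb => hQ hb.1
    choose w hwL hwK using fun j => hred (t j)
    refine ⟨⟨_, A, fun j => t j - w j, w⟩, hfar, hwK, fun j hj => htL j ?_, hwL, ?_, ?_⟩
    · have := add_mem hj (hwL j)
      rwa [sub_add_cancel] at this
    · simp only [weierstrassP_sub_mem _ (hwL _)]
      exact hprod
    · simp
  obtain ⟨d, hd⟩ := hex.choice
  have hτ : ∀ j, ∃ τ, Tendsto (fun E => (d E).2.2.1 j) U (𝓝 τ) := by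
    intro j
    obtain ⟨τ, -, hτ⟩ := hK.ultrafilter_le_nhds (U.map fun E => (d E).2.2.1 j)
      (le_principal_iff.mpr (hd.mono fun E hE => hE.2.1 j))
    exact ⟨τ, hτ⟩
  choose τ hτ using hτ
  have hmem := sum_limit_sub_sum_halfPeriod_mem hXi hU (fun E => (d E).2.1)
    (fun E => (d E).2.2.1) τ hτ (hd.mono fun E hE => hE.2.2.1)
    (hd.mono fun E hE => hE.2.2.2.2.1)
  have hlim : Tendsto (fun E => ∑ j, τ j - ∑ j, (d E).2.2.1 j) U (𝓝 0) := by
    have := (tendsto_const_nhds (x := ∑ j, τ j)).sub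
      (tendsto_finsetSum Finset.univ fun j _ => hτ j)
    rwa [sub_self] at this
  have hsmall := (tendsto_zero_iff_norm_tendsto_zero.mp hlim).eventually (gt_mem_nhds hε)
  obtain ⟨E, ⟨hfar, -, -, hwL, -, hα⟩, hE⟩ := (hd.and hsmall).exists
  refine absurd hE (not_lt.mpr ?_)
  have := hfar (-(∑ j, τ j - ∑ k : Fin 3, (l k.succ : ℂ) * halfPeriod L k.succ)
    - ∑ j, (d E).2.2.2 j) (sub_mem (neg_mem hmem) (sum_mem fun j _ => hwL j))
  rw [hα, Finset.sum_add_distrib] at this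
  refine this.trans_eq (congrArg _ ?_)
  ring
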